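/- A planar $st$-graph is a finite acyclic directed graph $G=(V,E)$ without parallel edges that has exactly one source $s$ and exactly one sink $t$ and is given with a fixed planar embedding in which $s$ and $t$ lie on the outer face (the edge $(s,t)$ need not be present). In such an embedding the outgoing edges of every vertex other than $s$ are consecutive around it. For a vertex $u$ let $S(u)=(v_1,\dots,v_m)$ be the list of the successors of $u$ in the clockwise order of the outgoing edges $(u,v_1),\dots,(u,v_m)$ around $u$; for $u\neq s$ it begins with the first outgoing edge after the incoming edges, and for $u=s$ it is cut at the outer face, that is, $v_m,s,v_1$ appear clockwise on the outer face. A bitonic $st$-ordering of $G$ is a bijection $\pi:V\to\{1,\dots,|V|\}$ with $\pi(s)=1$, $\pi(t)=|V|$ and $\pi(u)<\pi(v)$ for every edge $(u,v)\in E$, such that for every vertex $u$ with $S(u)=(v_1,\dots,v_m)$, $m\ge 1$, there is an $h$ with $1\le h\le m$ and $\pi(v_1)<\dots<\pi(v_h)>\dots>\pi(v_m)$. An edge $(u,v)$ is transitive if $G$ contains a directed path from $u$ to $v$ with at least two edges, and $G$ is reduced if it has no transitive edge. Every reduced planar $st$-graph (with its given embedding) admits a bitonic $st$-ordering. -/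

import Mathlib

namespace PlanarST

open Relation

/-! ### Directed graphs

A `Digraph V` is an adjacency relation, so there are no parallel edges. -/

section Directed

variable {V : Type*} (G : Digraph V)

/-- There is a directed path with at least one edge from `u` to `v`. -/
def HasPath (u v : V) : Prop := TransGen G.Adj u v

def IsSource (v : V) : Prop := ∀ u, ¬ G.Adj u v

def IsSink (v : V) : Prop := ∀ w, ¬ G.Adj v w

/-- An `st`-graph: an acyclic digraph whose only source is `s` and whose only sink is `t`. -/
structure IsSTGraph (s t : V) : Prop where
  acyclic : ∀ v, ¬ HasPath G v v
  source_iff : ∀ v, IsSource G v ↔ v = s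
  sink_iff : ∀ v, IsSink G v ↔ v = t

/-- The edge `(u, v)` is transitive: there is a directed path of at least two edges
from `u` to `v`. -/
def IsTransitiveEdge (u v : V) : Prop :=
  G.Adj u v ∧ ∃ w, G.Adj u w ∧ HasPath G w v

/-- There are no transitive edges. -/
def IsReduced : Prop := ∀ u v, ¬ IsTransitiveEdge G u v

end Directed

/-! ### Combinatorial embeddings

The embedding of a connected graph in the plane (sphere) is given by the clockwise cyclic order of
the darts (edges directed away from the vertex) around each vertex, subject to Euler's formula. -/

/-- A rotation system: `cw d` is the dart that follows `d` clockwise around the vertex `d.fst`. -/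
structure RotationSystem {V : Type*} (H : SimpleGraph V) where
  cw : Equiv.Perm H.Dart
  fst_cw : ∀ d, (cw d).fst = d.fst
  sameCycle_of_fst_eq : ∀ d e : H.Dart, d.fst = e.fst → cw.SameCycle d e

namespace RotationSystem

variable {V : Type*} {H : SimpleGraph V} (M : RotationSystem H)

/-- The dart that follows `d` on the boundary of the face to the left of `d`: walk along `d`, then
leave its end vertex by the dart that is clockwise next to the reverse of `d`. The angle at
`d.fst` between `M.cw.symm d` and `d` belongs to the face to the left of `d`. -/
def faceNext : Equiv.Perm H.Dart :=
  (Function.Involutive.toPerm SimpleGraph.Dart.symm SimpleGraph.Dart.symm_involutive).trans M.cw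

/-- A face of a connected graph, as the set of darts that have the face to their left: an orbit of
`faceNext`. The connected graph without edges (one vertex) has one face, the empty set of darts. -/
def IsFace (f : Set H.Dart) : Prop :=
  (∃ d, f = {e | M.faceNext.SameCycle d e}) ∨ (IsEmpty H.Dart ∧ f = ∅)

/-- The vertex `v` of a connected graph is on the boundary of the face `f` (an isolated vertex is
the whole graph and lies on its only face). -/
def OnFace (f : Set H.Dart) (v : V) : Prop :=
  (∃ d ∈ f, d.fst = v) ∨ ∀ d : H.Dart, d.fst ≠ v

/-- Euler's formula `|V| - |E| + |F| = 2`: the rotation system of a connected graph is that of an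
embedding in the sphere. -/
def IsPlanar : Prop :=
  Nat.card V + {f : Set H.Dart | M.IsFace f}.ncard = H.edgeSet.ncard + 2

end RotationSystem

/-- An embedded planar `st`-graph: an `st`-graph (which is always connected as an undirected graph)
with a planar embedding and a choice of outer face such that `s` and `t` are on the outer face. The
edge `(s, t)` need not be present. -/
structure EmbeddedPlanarSTGraph (V : Type*) where
  graph : Digraph V
  s : V
  t : V
  isSTGraph : IsSTGraph graph s t
  rot : RotationSystem graph.toSimpleGraphInclusive
  isPlanar : rot.IsPlanar
  outer : Set graph.toSimpleGraphInclusive.Dart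
  isFace_outer : rot.IsFace outer
  s_onFace : RotationSystem.OnFace outer s
  t_onFace : RotationSystem.OnFace outer t

namespace EmbeddedPlanarSTGraph

variable {V : Type*} (G : EmbeddedPlanarSTGraph V)

/-- `Dart`s of the underlying undirected graph of `G`. -/
abbrev Dart : Type _ := G.graph.toSimpleGraphInclusive.Dart

/-- All darts at the vertex `d.fst`, each once, clockwise and beginning with `d`. -/
noncomputable def clockwiseFrom (d : G.Dart) : List G.Dart :=
  List.iterate G.rot.cw d (G.graph.toSimpleGraphInclusive.neighborSet d.fst).ncard

/-- The clockwise list around a vertex, from which its successor list is read off, may begin with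
`d`. At `s` the angle between the last and the first dart of the list has to belong to the outer
face, so that `v_m, s, v_1` is clockwise on the outer face. At any other vertex the list begins with
an incoming edge; the outgoing edges being consecutive, they are then listed from the first to
the last one, whichever incoming edge is taken. -/
def IsStart (d : G.Dart) : Prop :=
  (d.fst = G.s ∧ d ∈ G.outer) ∨ (d.fst ≠ G.s ∧ G.graph.Adj d.snd d.fst)

open Classical in
/-- For `G.IsStart d`, the successor list `S(u) = (v_1, …, v_m)` of `u = d.fst`: the end vertices of
the outgoing edges of `u`, in clockwise order. -/
noncomputable def successorList (d : G.Dart) : List V :=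
  ((G.clockwiseFrom d).map fun e ↦ e.snd).filter fun v ↦ G.graph.Adj d.fst v

/-- `π` is the rank in an ordering `s = v_1, …, v_n = t` of all the vertices in which every edge
leads from a vertex to a later one. -/
structure IsSTOrdering (π : V → ℕ) : Prop where
  bijOn : Set.BijOn π Set.univ (Set.Icc 1 (Nat.card V))
  map_s : π G.s = 1
  map_t : π G.t = Nat.card V
  lt_of_adj : ∀ u v, G.graph.Adj u v → π u < π v

end EmbeddedPlanarSTGraph

/-- The list `v_1, …, v_m` satisfies `π v_1 < ⋯ < π v_h > ⋯ > π v_m` for some `h`; the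
empty list does as well. -/
def IsBitonic {V : Type*} (π : V → ℕ) (l : List V) : Prop :=
  l ≠ [] → ∃ h < l.length, ∀ i, ∀ hi : i + 1 < l.length,
    (i < h → π (l[i]) < π (l[i + 1])) ∧ (h ≤ i → π (l[i + 1]) < π (l[i]))

/-- An `st`-ordering for which the successor list of every vertex is bitonic. -/
def EmbeddedPlanarSTGraph.IsBitonicSTOrdering {V : Type*} (G : EmbeddedPlanarSTGraph V)
    (π : V → ℕ) : Prop :=
  G.IsSTOrdering π ∧ ∀ d : G.Dart, G.IsStart d → IsBitonic π (G.successorList d)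

end PlanarST

namespace PlanarST

open Relation

open scoped Classical

/-! ### Circulations on a plane graph -/

/-! Join any two clockwise-consecutive successors of a vertex by an additional edge from left to
right, except across the outer angle of `s`. If the augmented graph is acyclic, a linear extension
of it makes every successor list increasing, hence bitonic with the peak at the end.

Acyclicity (`augAdj_acyclic`) is proved by duality. Replacing each additional edge by the two edges
of its angle turns a closed walk into a circulation, which by Euler's formula is the coboundary of a
face potential `ψ` (`exists_face_potential`). A second potential `φ` drops from left to right across
every edge that does not have the outer face on its left (`exists_strict_potential`). Moving left,
`ψ` cannot exceed its outer value: reducedness gives every inner face an edge on its left side that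
no detour traverses backwards (`exists_consecutive_not_isOut`). Moving right through the source
angles, `ψ` minus the detour flow cannot fall below that value. So `ψ` is constant and the flow
vanishes.

The local structure (consecutive outgoing edges, one source and one sink angle per face) is the
equality case of a count (`injOn_changes`). -/

theorem eq_of_sameCycle {α β : Type*} {σ : Equiv.Perm α} {f : α → β} (hf : ∀ x, f (σ x) = f x)
    {x y : α} (h : σ.SameCycle x y) : f x = f y := by
  obtain ⟨n, rfl⟩ := h
  induction n using Int.induction_on with
  | zero => simp
  | succ n ih => rw [ih, add_comm, zpow_add, zpow_one, Equiv.Perm.mul_apply, hf]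
  | pred n ih =>
    rw [ih, ← hf ((σ ^ (-(n : ℤ) - 1)) x), ← Equiv.Perm.mul_apply, ← zpow_one_add]
    congr 3
    ring

instance finite_dart {V : Type*} [Finite V] {H : SimpleGraph V} : Finite H.Dart :=
  Finite.of_injective _ (SimpleGraph.Dart.toProd_injective (G := H))

theorem finrank_span_singleton_le_one {K W : Type*} [DivisionRing K] [AddCommGroup W] [Module K W]
    (w : W) : Module.finrank K (Submodule.span K {w}) ≤ 1 :=
  (finrank_span_le_card {w}).trans (by simp)

/-! ### Faces as orbits of `faceNext` -/

namespace RotationSystem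

variable {V : Type*} {H : SimpleGraph V} (M : RotationSystem H)

theorem faceNext_apply (d : H.Dart) : M.faceNext d = M.cw d.symm := rfl

theorem fst_faceNext (d : H.Dart) : (M.faceNext d).fst = d.snd := by
  rw [faceNext_apply, M.fst_cw]; rfl

theorem symm_faceNext_symm (d : H.Dart) : (M.faceNext.symm d).symm = M.cw.symm d := by
  rw [Equiv.eq_symm_apply, ← faceNext_apply, Equiv.apply_symm_apply]

/-- The face to the left of a dart. -/
abbrev Face : Type _ := Quotient (Equiv.Perm.SameCycle.setoid M.faceNext)

abbrev face (d : H.Dart) : M.Face := Quotient.mk _ d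

theorem face_eq_iff {d e : H.Dart} : M.face d = M.face e ↔ M.faceNext.SameCycle d e :=
  Quotient.eq (r := Equiv.Perm.SameCycle.setoid M.faceNext)

theorem face_faceNext (d : H.Dart) : M.face (M.faceNext d) = M.face d :=
  M.face_eq_iff.2 (Equiv.Perm.sameCycle_apply_left.2 (Equiv.Perm.SameCycle.refl _ _))

theorem face_cw (d : H.Dart) : M.face (M.cw d) = M.face d.symm := by
  rw [← face_faceNext M d.symm, faceNext_apply, SimpleGraph.Dart.symm_symm]

theorem ncard_isFace [Nonempty H.Dart] : {f : Set H.Dart | M.IsFace f}.ncard = Nat.card M.Face := by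
  let F : M.Face → Set H.Dart := fun q ↦ {e | M.face e = q}
  have hF : F.Injective := by
    intro p q h
    induction p using Quotient.inductionOn with | _ d =>
    exact (show d ∈ F q from h ▸ rfl)
  rw [← Nat.card_range_of_injective hF, ← Nat.card_coe_set_eq]
  congr 2
  ext f
  constructor
  · rintro (⟨d, rfl⟩ | ⟨h, -⟩)
    · refine ⟨M.face d, ?_⟩
      ext e
      exact eq_comm.trans M.face_eq_iff
    · exact (h.false (Classical.arbitrary _)).elim
  · rintro ⟨q, rfl⟩
    induction q using Quotient.inductionOn with | _ d =>
    refine Or.inl ⟨d, ?_⟩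
    ext e
    exact eq_comm.trans M.face_eq_iff

variable {M}

/-- The two invariances give invariance under `cw`, which is transitive on the darts at a vertex;
connectedness does the rest. -/
theorem eq_of_invariant (hH : H.Connected) {α : Type*} {f : H.Dart → α}
    (hface : ∀ d, f (M.faceNext d) = f d) (hsymm : ∀ d, f d.symm = f d) (d e : H.Dart) :
    f d = f e := by
  have hcw : ∀ d, f (M.cw d) = f d := fun d ↦ by
    rw [← hsymm d, ← hface d.symm, faceNext_apply, SimpleGraph.Dart.symm_symm]
  have hv : ∀ d e : H.Dart, d.fst = e.fst → f d = f e := fun d e h ↦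
    eq_of_sameCycle hcw (M.sameCycle_of_fst_eq d e h)
  obtain ⟨p⟩ := hH.preconnected d.fst e.fst
  have key : ∀ {u v : V} (_ : H.Walk u v) (d e : H.Dart), d.fst = u → e.fst = v → f d = f e := by
    intro u v p
    induction p with
    | nil => exact fun d e h h' ↦ hv d e (h.trans h'.symm)
    | cons h p ih =>
      intro d e hd he
      rw [hv d ⟨(_, _), h⟩ hd, ← hsymm]
      exact ih _ _ rfl he
  exact key p d e rfl rfl

variable (M) in
/-- The functions on the darts that are the sum of a function of the edge and one of the face. -/
noncomputable def edgeFaceSum : ((H.edgeSet → ℚ) × (M.Face → ℚ)) →ₗ[ℚ] (H.Dart → ℚ) :=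
  (LinearMap.funLeft ℚ ℚ fun d : H.Dart ↦ (⟨d.edge, d.edge_mem⟩ : H.edgeSet)).coprod
    (LinearMap.funLeft ℚ ℚ M.face)

theorem edgeFaceSum_apply (a : H.edgeSet → ℚ) (ψ : M.Face → ℚ) (d : H.Dart) :
    M.edgeFaceSum (a, ψ) d = a ⟨d.edge, d.edge_mem⟩ + ψ (M.face d) := rfl

/-- A vanishing sum forces `ψ` to agree on both sides of every edge, so it is constant and `a` is
its negative. -/
theorem finrank_ker_edgeFaceSum_le (hH : H.Connected) [Nonempty H.Dart] :
    Module.finrank ℚ (LinearMap.ker M.edgeFaceSum) ≤ 1 := by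
  have hle : LinearMap.ker M.edgeFaceSum ≤
      Submodule.span ℚ {((-1, 1) : (H.edgeSet → ℚ) × (M.Face → ℚ))} := by
    rintro ⟨a, ψ⟩ h
    have h0 : ∀ d : H.Dart, a ⟨d.edge, d.edge_mem⟩ = -ψ (M.face d) := fun d ↦
      eq_neg_of_add_eq_zero_left (congrFun h d)
    obtain ⟨d₀⟩ := ‹Nonempty H.Dart›
    have hc : ∀ d, ψ (M.face d) = ψ (M.face d₀) := fun d ↦
      eq_of_invariant (M := M) hH (f := fun d ↦ ψ (M.face d)) (fun d ↦ by rw [face_faceNext])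
        (fun d ↦ by
          rw [← neg_inj, ← h0, ← h0]
          congr 2
          exact d.edge_symm) d d₀
    refine Submodule.mem_span_singleton.2 ⟨ψ (M.face d₀), Prod.ext ?_ ?_⟩
    · funext ⟨e, he⟩
      induction e using Sym2.ind with | _ u v =>
      have := h0 ⟨(u, v), he⟩
      rw [hc] at this
      simpa [SimpleGraph.Dart.edge] using this.symm
    · funext q
      induction q using Quotient.inductionOn with | _ d =>
      simpa using (hc d).symm
  exact (Submodule.finrank_mono hle).trans (finrank_span_singleton_le_one _)

/-! ### Net outflow and the dimension count -/

variable [Fintype V]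

variable (H) in
/-- The net amount that a function on the darts, viewed as a flow, carries out of each vertex. -/
noncomputable def netOut : (H.Dart → ℚ) →ₗ[ℚ] (V → ℚ) :=
  Fintype.linearCombination ℚ fun d : H.Dart ↦ Pi.single d.fst 1 - Pi.single d.snd 1

theorem netOut_apply (y : H.Dart → ℚ) :
    netOut H y = ∑ d : H.Dart, y d • (Pi.single d.fst (1 : ℚ) - Pi.single d.snd 1 : V → ℚ) := rfl

theorem netOut_single (d : H.Dart) :
    netOut H (Pi.single d 1) = Pi.single d.fst 1 - Pi.single d.snd 1 := by
  rw [netOut, Fintype.linearCombination_apply_single, one_smul]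

theorem netOut_of_symm {y : H.Dart → ℚ} (hy : ∀ d, y d.symm = y d) : netOut H y = 0 := by
  have h : netOut H y = -netOut H y := by
    rw [netOut_apply, ← Finset.sum_neg_distrib]
    refine Fintype.sum_equiv (SimpleGraph.Dart.symm_involutive.toPerm _) _ _ fun d ↦ ?_
    change _ = -(y d.symm • (Pi.single d.snd (1 : ℚ) - Pi.single d.fst 1 : V → ℚ))
    rw [hy, ← smul_neg, neg_sub]
  exact self_eq_neg.1 h

theorem netOut_of_faceNext {y : H.Dart → ℚ} (hy : ∀ d, y (M.faceNext d) = y d) :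
    netOut H y = 0 := by
  simp only [netOut_apply, smul_sub, Finset.sum_sub_distrib, sub_eq_zero]
  symm
  refine Fintype.sum_equiv M.faceNext _ _ fun d ↦ ?_
  rw [hy, fst_faceNext]

theorem card_le_finrank_range_netOut (hH : H.Connected) :
    Fintype.card V ≤ Module.finrank ℚ (LinearMap.range (netOut H)) + 1 := by
  obtain ⟨s⟩ := hH.nonempty
  have htop : LinearMap.range (netOut H) ⊔ Submodule.span ℚ {Pi.single s (1 : ℚ)} = ⊤ := by
    have key : ∀ {u v : V} (_ : H.Walk u v),
        (Pi.single u (1 : ℚ) : V → ℚ) - Pi.single v 1 ∈ LinearMap.range (netOut H) := by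
      intro u v p
      induction p with
      | nil => simp
      | @cons u v w h p ih =>
        rw [← sub_add_sub_cancel _ (Pi.single v (1 : ℚ) : V → ℚ)]
        exact add_mem ⟨_, netOut_single ⟨(u, v), h⟩⟩ ih
    rw [eq_top_iff, ← (Pi.basisFun ℚ V).span_eq, Submodule.span_le]
    rintro _ ⟨v, rfl⟩
    obtain ⟨p⟩ := hH.preconnected v s
    rw [Pi.basisFun_apply, ← sub_add_cancel (Pi.single v (1 : ℚ) : V → ℚ) (Pi.single s 1)]
    exact Submodule.add_mem_sup (key p) (Submodule.mem_span_singleton_self _)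
  calc Fintype.card V = Module.finrank ℚ (⊤ : Submodule ℚ (V → ℚ)) := by simp
    _ ≤ _ := by
      rw [← htop]
      exact (Submodule.finrank_add_le_finrank_add_finrank _ _).trans
        (Nat.add_le_add_left (finrank_span_singleton_le_one _) _)

theorem card_dart : Fintype.card H.Dart = 2 * H.edgeSet.ncard := by
  rw [SimpleGraph.dart_card_eq_twice_card_edges, ← SimpleGraph.coe_edgeFinset,
    Set.ncard_coe_finset]

/-- Every circulation on a connected plane graph is the coboundary of a function on the faces. -/
theorem exists_face_potential (hM : M.IsPlanar) (hH : H.Connected) {y : H.Dart → ℚ}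
    (hy : netOut H y = 0) :
    ∃ ψ : M.Face → ℚ, ∀ d, y d - y d.symm = ψ (M.face d) - ψ (M.face d.symm) := by
  cases isEmpty_or_nonempty H.Dart with
  | inl h => exact ⟨0, fun d ↦ (h.false d).elim⟩
  | inr h =>
  have hle : LinearMap.range M.edgeFaceSum ≤ LinearMap.ker (netOut H) := by
    rintro _ ⟨⟨a, ψ⟩, rfl⟩
    have : M.edgeFaceSum (a, ψ) =
        (fun d : H.Dart ↦ a ⟨d.edge, d.edge_mem⟩) + fun d ↦ ψ (M.face d) := rfl
    rw [LinearMap.mem_ker, this, map_add, netOut_of_symm, netOut_of_faceNext (M := M), add_zero]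
    · exact fun d ↦ by rw [face_faceNext]
    · intro d
      congr 2
      exact d.edge_symm
  have h1 := card_le_finrank_range_netOut hH
  have h2 := finrank_ker_edgeFaceSum_le (M := M) hH
  have h3 := LinearMap.finrank_range_add_finrank_ker (netOut H)
  have h4 := LinearMap.finrank_range_add_finrank_ker M.edgeFaceSum
  have h5 := hM
  rw [IsPlanar, ncard_isFace, Nat.card_eq_fintype_card, Nat.card_eq_fintype_card] at h5
  rw [Module.finrank_prod] at h4
  simp only [Module.finrank_fintype_fun_eq_card] at h3 h4
  rw [card_dart] at h3
  rw [← Nat.card_eq_fintype_card (α := H.edgeSet), Nat.card_coe_set_eq] at h4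
  -- The range has dimension at least `|E| + |F| - 1`, the kernel at most `2|E| - |V| + 1`; Euler's
  -- formula makes these equal.
  have heq := Submodule.eq_of_le_of_finrank_le hle (by omega)
  obtain ⟨⟨a, ψ⟩, rfl⟩ : y ∈ LinearMap.range M.edgeFaceSum := heq ▸ hy
  refine ⟨ψ, fun d ↦ ?_⟩
  have : (⟨d.symm.edge, d.symm.edge_mem⟩ : H.edgeSet) = ⟨d.edge, d.edge_mem⟩ :=
    Subtype.ext d.edge_symm
  rw [edgeFaceSum_apply, edgeFaceSum_apply, this]
  ring

end RotationSystem

/-! ### Changes of orientation along faces and around vertices -/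

theorem exists_change {α : Type*} [Finite α] {σ : Equiv.Perm α} {p : α → Prop} {x y : α}
    (h : σ.SameCycle x y) (hx : p x) (hy : ¬ p y) : ∃ z, σ.SameCycle x z ∧ p z ∧ ¬ p (σ z) := by
  by_contra! hc
  obtain ⟨n, rfl⟩ := h.exists_nat_pow_eq
  refine hy ?_
  clear hy h
  induction n with
  | zero => exact hx
  | succ n ih =>
    rw [pow_succ', Equiv.Perm.mul_apply]
    exact hc _ ⟨n, by simp⟩ ih

theorem RotationSystem.transGen_of_forall_faceNext {V : Type*} [Finite V] {H : SimpleGraph V}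
    {M : RotationSystem H} {r : V → V → Prop} {d : H.Dart}
    (h : ∀ e, M.faceNext.SameCycle d e → r e.fst e.snd) : TransGen r d.fst d.fst := by
  have key : ∀ n, TransGen r d.fst ((M.faceNext ^ n) d).snd := by
    intro n
    induction n with
    | zero => exact .single (h d (Equiv.Perm.SameCycle.refl _ _))
    | succ n ih =>
      refine ih.tail ?_
      have := h ((M.faceNext ^ (n + 1)) d) ⟨n + 1, by norm_cast⟩
      rw [pow_succ', Equiv.Perm.mul_apply] at this ⊢
      rwa [M.fst_faceNext] at this
  -- At a positive return time `n` the walk closes; its last dart has index `n - 1`.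
  obtain ⟨n, hn, -, h⟩ := (Equiv.Perm.SameCycle.refl M.faceNext d).exists_pow_eq''
  have := key (n - 1)
  rwa [← M.fst_faceNext, ← Equiv.Perm.mul_apply, ← pow_succ', Nat.sub_add_cancel hn, h] at this

namespace EmbeddedPlanarSTGraph

variable {V : Type*} {G : EmbeddedPlanarSTGraph V}

/-- The dart leads along an edge of `G` in its direction. -/
def IsOut (d : G.Dart) : Prop := G.graph.Adj d.fst d.snd

theorem not_adj_symm {u v : V} (h : G.graph.Adj u v) : ¬ G.graph.Adj v u := fun h' ↦
  G.isSTGraph.acyclic u (.tail (.single h) h')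

theorem ne_of_adj {u v : V} (h : G.graph.Adj u v) : u ≠ v := by
  rintro rfl
  exact not_adj_symm h h

theorem isOut_symm_iff {d : G.Dart} : IsOut d.symm ↔ ¬ IsOut d :=
  ⟨not_adj_symm, ((SimpleGraph.fromRel_adj _ _ _).1 d.adj).2.resolve_left⟩

/-- The dart along an edge of `G`. -/
def dart {u v : V} (h : G.graph.Adj u v) : G.Dart :=
  ⟨(u, v), (SimpleGraph.fromRel_adj _ _ _).2 ⟨ne_of_adj h, .inl h⟩⟩

theorem isOut_dart {u v : V} (h : G.graph.Adj u v) : IsOut (dart h) := h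

theorem isOut_of_fst_eq_s {d : G.Dart} (h : d.fst = G.s) : IsOut d := by
  by_contra hd
  exact (G.isSTGraph.source_iff _).2 h _ (isOut_symm_iff.2 hd)

theorem fst_eq_of_sameCycle_cw {d e : G.Dart} (h : G.rot.cw.SameCycle d e) : d.fst = e.fst :=
  eq_of_sameCycle (f := fun d : G.Dart ↦ d.fst) G.rot.fst_cw h

theorem outer_eq [Nonempty G.Dart] {o d : G.Dart} (ho : o ∈ G.outer) :
    d ∈ G.outer ↔ G.rot.face d = G.rot.face o := by
  obtain ⟨e, he⟩ | h := G.isFace_outer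
  · rw [he] at ho ⊢
    rw [← G.rot.face_eq_iff.2 ho, eq_comm, G.rot.face_eq_iff]
    rfl
  · exact (h.1.false d).elim

variable (G) in
/-- The darts that end a source angle of a face. -/
def sourceDarts : Set G.Dart := {d | IsOut d ∧ IsOut (G.rot.cw.symm d)}

theorem mem_sourceDarts_of_fst_eq_s {d : G.Dart} (h : d.fst = G.s) : d ∈ G.sourceDarts := by
  refine ⟨isOut_of_fst_eq_s h, isOut_of_fst_eq_s ?_⟩
  rw [← h, ← G.rot.fst_cw, Equiv.apply_symm_apply]

/-! ### Reachability, and the Euler count of orientation changes -/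

variable [Finite V]

variable (G) in
theorem reach_from_s (v : V) : ReflTransGen G.graph.Adj G.s v := by
  have : IsTrans V (TransGen G.graph.Adj) := inferInstance
  have : Std.Irrefl (TransGen G.graph.Adj) := ⟨G.isSTGraph.acyclic⟩
  have wf := Finite.wellFounded_of_trans_of_irrefl (TransGen G.graph.Adj)
  induction v using wf.induction with | _ v ih =>
  by_cases h : IsSource G.graph v
  · rw [(G.isSTGraph.source_iff v).1 h]
  · simp only [IsSource, not_forall, not_not] at h
    obtain ⟨u, hu⟩ := h
    exact (ih u (.single hu)).tail hu

variable (G) in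
theorem reach_to_t (v : V) : ReflTransGen G.graph.Adj v G.t := by
  have : IsTrans V (TransGen (Function.swap G.graph.Adj)) := inferInstance
  have : Std.Irrefl (TransGen (Function.swap G.graph.Adj)) :=
    ⟨fun v h ↦ G.isSTGraph.acyclic v (transGen_swap.1 h)⟩
  have wf := Finite.wellFounded_of_trans_of_irrefl (TransGen (Function.swap G.graph.Adj))
  induction v using wf.induction with | _ v ih =>
  by_cases h : IsSink G.graph v
  · rw [(G.isSTGraph.sink_iff v).1 h]
  · simp only [IsSink, not_forall, not_not] at h
    obtain ⟨u, hu⟩ := h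
    exact (ih u (.single hu)).head hu

variable (G) in
theorem connected : G.graph.toSimpleGraphInclusive.Connected := by
  have key : ∀ v, G.graph.toSimpleGraphInclusive.Reachable G.s v := by
    intro v
    induction reach_from_s G v with
    | refl => exact .refl _
    | tail _ h ih => exact ih.trans (SimpleGraph.Adj.reachable (dart h).adj)
  have : Nonempty V := ⟨G.s⟩
  exact ⟨fun u v ↦ (key u).symm.trans (key v)⟩

theorem s_ne_t [h : Nonempty G.Dart] : G.s ≠ G.t := by
  intro hst
  have hs : ∀ v, v = G.s := by
    intro v
    induction reach_from_s G v with
    | refl => rfl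
    | tail _ h ih => exact ((G.isSTGraph.sink_iff _).2 (ih.trans hst) _ h).elim
  obtain ⟨d⟩ := h
  exact d.adj.ne ((hs _).trans (hs _).symm)

theorem exists_isOut_sameCycle (d : G.Dart) : ∃ e, G.rot.faceNext.SameCycle d e ∧ IsOut e := by
  by_contra! h
  refine G.isSTGraph.acyclic d.fst (transGen_swap.1 (?_ : TransGen (Function.swap _) _ _))
  exact RotationSystem.transGen_of_forall_faceNext (fun e he ↦ isOut_symm_iff.2 (h e he))

theorem exists_not_isOut_sameCycle (d : G.Dart) :
    ∃ e, G.rot.faceNext.SameCycle d e ∧ ¬ IsOut e := by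
  by_contra! h
  exact G.isSTGraph.acyclic d.fst (RotationSystem.transGen_of_forall_faceNext h)

theorem exists_sink_change (d : G.Dart) : ∃ e, G.rot.face e = G.rot.face d ∧
    IsOut e ∧ ¬ IsOut (G.rot.faceNext e) := by
  obtain ⟨x, hx, hx'⟩ := exists_isOut_sameCycle d
  obtain ⟨y, hy, hy'⟩ := exists_not_isOut_sameCycle d
  obtain ⟨z, hz, h⟩ := exists_change (hx.symm.trans hy) hx' hy'
  exact ⟨z, G.rot.face_eq_iff.2 (hx.trans hz).symm, h⟩

theorem exists_source_change (d : G.Dart) : ∃ e, G.rot.face e = G.rot.face d ∧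
    ¬ IsOut e ∧ IsOut (G.rot.faceNext e) := by
  obtain ⟨x, hx, hx'⟩ := exists_isOut_sameCycle d
  obtain ⟨y, hy, hy'⟩ := exists_not_isOut_sameCycle d
  obtain ⟨z, hz, h, h'⟩ := exists_change (p := fun d ↦ ¬ IsOut d) (hy.symm.trans hx) hy'
    (not_not.2 hx')
  exact ⟨z, G.rot.face_eq_iff.2 (hy.trans hz).symm, h, not_not.1 h'⟩

theorem exists_changes_at {v : V} (hs : v ≠ G.s) (ht : v ≠ G.t) :
    (∃ d : G.Dart, d.fst = v ∧ IsOut d ∧ ¬ IsOut (G.rot.cw d)) ∧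
      ∃ d : G.Dart, d.fst = v ∧ ¬ IsOut d ∧ IsOut (G.rot.cw d) := by
  obtain ⟨u, hu⟩ : ∃ u, G.graph.Adj u v := by
    have := mt (G.isSTGraph.source_iff v).1 hs
    simpa only [IsSource, not_forall, not_not] using this
  obtain ⟨w, hw⟩ : ∃ w, G.graph.Adj v w := by
    have := mt (G.isSTGraph.sink_iff v).1 ht
    simpa only [IsSink, not_forall, not_not] using this
  have h := G.rot.sameCycle_of_fst_eq (dart hw) (dart hu).symm rfl
  have hd : ¬ IsOut (dart hu).symm := fun h ↦ isOut_symm_iff.1 h (isOut_dart hu)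
  constructor
  · obtain ⟨z, hz, hz'⟩ := exists_change h (isOut_dart hw) hd
    exact ⟨z, (fst_eq_of_sameCycle_cw hz).symm, hz'⟩
  · obtain ⟨z, hz, hz', hz''⟩ := exists_change (p := fun d ↦ ¬ IsOut d) h.symm hd
      (not_not.2 (isOut_dart hw))
    exact ⟨z, (fst_eq_of_sameCycle_cw hz).symm, hz', not_not.1 hz''⟩

/-- Around every vertex there is at most one change from incoming to outgoing edges, and along
every face there is at most one change of either kind. -/
theorem injOn_changes [Nonempty G.Dart] :
    Set.InjOn (fun d : G.Dart ↦ d.fst) {d | ¬ IsOut d ∧ IsOut (G.rot.cw d)} ∧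
    Set.InjOn G.rot.face {d | IsOut d ∧ ¬ IsOut (G.rot.faceNext d)} ∧
    Set.InjOn G.rot.face {d | ¬ IsOut d ∧ IsOut (G.rot.faceNext d)} := by
  cases nonempty_fintype V
  let A : Finset G.Dart := {d | IsOut d ∧ ¬ IsOut (G.rot.cw d)}
  let B : Finset G.Dart := {d | ¬ IsOut d ∧ IsOut (G.rot.cw d)}
  let C : Finset G.Dart := {d | IsOut d ∧ ¬ IsOut (G.rot.faceNext d)}
  let D : Finset G.Dart := {d | ¬ IsOut d ∧ IsOut (G.rot.faceNext d)}
  -- Reversing darts turns the changes along faces into the non-changes around vertices.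
  have hC : C.card = ({d | ¬ IsOut d ∧ ¬ IsOut (G.rot.cw d)} : Finset G.Dart).card := by
    refine Finset.card_equiv (SimpleGraph.Dart.symm_involutive.toPerm _) fun d ↦ ?_
    simp only [C, Finset.mem_filter_univ]
    simp only [Function.Involutive.coe_toPerm, isOut_symm_iff, not_not, G.rot.faceNext_apply]
  have hD : D.card = ({d | IsOut d ∧ IsOut (G.rot.cw d)} : Finset G.Dart).card := by
    refine Finset.card_equiv (SimpleGraph.Dart.symm_involutive.toPerm _) fun d ↦ ?_
    simp only [D, Finset.mem_filter_univ]
    simp only [Function.Involutive.coe_toPerm, isOut_symm_iff, G.rot.faceNext_apply]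
  have hsum : A.card + B.card + C.card + D.card = Fintype.card G.Dart := by
    rw [hC, hD, Finset.card_filter, Finset.card_filter, Finset.card_filter, Finset.card_filter,
      ← Finset.sum_add_distrib, ← Finset.sum_add_distrib, ← Finset.sum_add_distrib,
      ← Finset.card_univ, Finset.card_eq_sum_ones]
    refine Finset.sum_congr rfl fun d _ ↦ ?_
    by_cases h : IsOut d <;> by_cases h' : IsOut (G.rot.cw d) <;> simp [h, h']
  have hcompl : ({G.s, G.t}ᶜ : Finset V).card + 2 = Fintype.card V := by
    rw [← Finset.card_pair (s_ne_t (G := G)), Finset.card_compl_add_card]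
  have hA' : ({G.s, G.t}ᶜ : Finset V).card ≤ (A.image fun d ↦ d.fst).card := by
    refine Finset.card_le_card fun v hv ↦ ?_
    simp only [Finset.mem_compl, Finset.mem_insert, Finset.mem_singleton, not_or] at hv
    obtain ⟨d, hd, h⟩ := (exists_changes_at hv.1 hv.2).1
    exact Finset.mem_image.2 ⟨d, by simpa [A] using h, hd⟩
  have hB' : ({G.s, G.t}ᶜ : Finset V).card ≤ (B.image fun d ↦ d.fst).card := by
    refine Finset.card_le_card fun v hv ↦ ?_
    simp only [Finset.mem_compl, Finset.mem_insert, Finset.mem_singleton, not_or] at hv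
    obtain ⟨d, hd, h⟩ := (exists_changes_at hv.1 hv.2).2
    exact Finset.mem_image.2 ⟨d, by simpa [B] using h, hd⟩
  have hC' : Fintype.card G.rot.Face ≤ (C.image G.rot.face).card := by
    rw [← Finset.card_univ]
    refine Finset.card_le_card fun q _ ↦ ?_
    induction q using Quotient.inductionOn with | _ d =>
    obtain ⟨e, he, h⟩ := exists_sink_change d
    exact Finset.mem_image.2 ⟨e, by simpa [C] using h, he⟩
  have hD' : Fintype.card G.rot.Face ≤ (D.image G.rot.face).card := by
    rw [← Finset.card_univ]
    refine Finset.card_le_card fun q _ ↦ ?_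
    induction q using Quotient.inductionOn with | _ d =>
    obtain ⟨e, he, h⟩ := exists_source_change d
    exact Finset.mem_image.2 ⟨e, by simpa [D] using h, he⟩
  have hA'' := Finset.card_image_le (s := A) (f := fun d : G.Dart ↦ d.fst)
  have hB'' := Finset.card_image_le (s := B) (f := fun d : G.Dart ↦ d.fst)
  have hC'' := Finset.card_image_le (s := C) (f := G.rot.face)
  have hD'' := Finset.card_image_le (s := D) (f := G.rot.face)
  have hE := G.isPlanar
  rw [RotationSystem.IsPlanar, RotationSystem.ncard_isFace, Nat.card_eq_fintype_card,
    Nat.card_eq_fintype_card] at hE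
  rw [RotationSystem.card_dart] at hsum
  -- The lower bounds add up to `2(|V| - 2) + 2|F| = 2|E|`, the number of darts, so all of them are
  -- equalities.
  have iB : (B.image fun d ↦ d.fst).card = B.card := by omega
  have iC : (C.image G.rot.face).card = C.card := by omega
  have iD : (D.image G.rot.face).card = D.card := by omega
  rw [Finset.card_image_iff] at iB iC iD
  simp only [B, C, D, Finset.coe_filter_univ] at iB iC iD
  exact ⟨iB, iC, iD⟩

/-! ### The outer face and the source angles -/

theorem exists_mem_outer_fst_eq_s [Nonempty G.Dart] : ∃ d ∈ G.outer, d.fst = G.s := by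
  refine G.s_onFace.resolve_right fun h ↦ ?_
  refine s_ne_t (G := G) ((G.isSTGraph.sink_iff _).1 fun w hw ↦ h (dart hw) rfl)

theorem exists_mem_outer_fst_eq_t [Nonempty G.Dart] : ∃ d ∈ G.outer, d.fst = G.t := by
  refine G.t_onFace.resolve_right fun h ↦ ?_
  refine s_ne_t (G := G) ((G.isSTGraph.source_iff _).1 fun w hw ↦ h (dart hw).symm rfl).symm

theorem exists_mem_sourceDarts (d : G.Dart) :
    ∃ e ∈ G.sourceDarts, G.rot.face e = G.rot.face d := by
  obtain ⟨e, he, h, h'⟩ := exists_source_change d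
  refine ⟨G.rot.faceNext e, ⟨h', ?_⟩, (G.rot.face_faceNext e).trans he⟩
  rwa [← G.rot.symm_faceNext_symm, Equiv.symm_apply_apply, isOut_symm_iff]

/-- A source angle is a change from backward to forward along the face, and there is only one. -/
theorem sourceDarts_injOn : Set.InjOn G.rot.face G.sourceDarts := by
  intro d hd e he h
  have : Nonempty G.Dart := ⟨d⟩
  have key : ∀ d ∈ G.sourceDarts, G.rot.faceNext.symm d ∈
      {d | ¬ IsOut d ∧ IsOut (G.rot.faceNext d)} := by
    rintro d ⟨h, h'⟩
    rw [← G.rot.symm_faceNext_symm, isOut_symm_iff] at h'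
    exact ⟨h', by rwa [Equiv.apply_symm_apply]⟩
  refine G.rot.faceNext.symm.injective (injOn_changes.2.2 (key d hd) (key e he) ?_)
  rw [← G.rot.face_faceNext, Equiv.apply_symm_apply, h,
    ← G.rot.face_faceNext (G.rot.faceNext.symm e), Equiv.apply_symm_apply]

/-- The outer face already has a source angle at `s`, hence no other. -/
theorem fst_eq_s_of_mem_sourceDarts {d : G.Dart} (hd : d ∈ G.sourceDarts) (h : d ∈ G.outer) :
    d.fst = G.s := by
  have : Nonempty G.Dart := ⟨d⟩
  obtain ⟨o, ho, hos⟩ := exists_mem_outer_fst_eq_s (G := G)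
  rwa [sourceDarts_injOn hd (mem_sourceDarts_of_fst_eq_s hos) ((outer_eq ho).1 h)]

theorem eq_of_mem_outer {d e : G.Dart} (hd : d ∈ G.outer) (he : e ∈ G.outer) (hds : d.fst = G.s)
    (hes : e.fst = G.s) : d = e :=
  have : Nonempty G.Dart := ⟨d⟩
  sourceDarts_injOn (mem_sourceDarts_of_fst_eq_s hds) (mem_sourceDarts_of_fst_eq_s hes)
    ((outer_eq he).1 hd)

end EmbeddedPlanarSTGraph

namespace EmbeddedPlanarSTGraph

variable {V : Type*} {G : EmbeddedPlanarSTGraph V}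

/-! ### The augmented graph -/

variable (G) in
/-- The edges of `G` together with an edge between any two consecutive successors of a vertex, from
the left one to the right one. -/
def AugAdj (u v : V) : Prop :=
  G.graph.Adj u v ∨ ∃ d : G.Dart, IsOut d ∧ IsOut (G.rot.cw d) ∧ G.rot.cw d ∉ G.outer ∧
    d.snd = u ∧ (G.rot.cw d).snd = v

variable (G) in
/-- A nonzero flow `x` along edges of `G` and `w` along additional edges. An additional edge that
belongs to the angle between `G.rot.cw.symm d` and `d` is replaced by this pair of edges, the first
one being traversed backwards. -/
structure IsAugFlow (x w : G.Dart → ℚ) : Prop where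
  nonneg_left : 0 ≤ x
  nonneg_right : 0 ≤ w
  isOut : ∀ d, ¬ IsOut d → x d = 0
  mem_sourceDarts : ∀ d ∉ G.sourceDarts, w d = 0
  not_mem_outer : ∀ d ∈ G.outer, w d = 0
  pos : ∃ d, 0 < x d + w d

theorem IsAugFlow.add {x w x' w' : G.Dart → ℚ} (h : G.IsAugFlow x w) (h' : G.IsAugFlow x' w') :
    G.IsAugFlow (x + x') (w + w') where
  nonneg_left := add_nonneg h.1 h'.1
  nonneg_right := add_nonneg h.2 h'.2
  isOut d hd := by rw [Pi.add_apply, h.isOut d hd, h'.isOut d hd, add_zero]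
  mem_sourceDarts d hd := by
    rw [Pi.add_apply, h.mem_sourceDarts d hd, h'.mem_sourceDarts d hd, add_zero]
  not_mem_outer d hd := by
    rw [Pi.add_apply, h.not_mem_outer d hd, h'.not_mem_outer d hd, add_zero]
  pos := by
    obtain ⟨d, hd⟩ := h.pos
    refine ⟨d, ?_⟩
    have h1 : 0 ≤ x' d := h'.1 d
    have h2 : 0 ≤ w' d := h'.2 d
    simp only [Pi.add_apply]
    linarith

variable [Finite V]

/-- In a reduced graph, the boundary of every inner face has two consecutive edges on the side
that runs against its direction. -/
theorem exists_consecutive_not_isOut (hG : IsReduced G.graph) {d : G.Dart} (hd : d ∉ G.outer) :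
    ∃ b, G.rot.face b = G.rot.face d ∧ ¬ IsOut b ∧ ¬ IsOut (G.rot.faceNext b) := by
  have : Nonempty G.Dart := ⟨d⟩
  obtain ⟨e, hed, he, heb⟩ := exists_sink_change d
  set b := G.rot.faceNext e with hb
  have hbd : G.rot.face b = G.rot.face d := (G.rot.face_faceNext e).trans hed
  refine ⟨b, hbd, heb, fun hg ↦ ?_⟩
  set g := G.rot.faceNext b with hgb
  have hge : G.rot.faceNext.SameCycle g e :=
    G.rot.face_eq_iff.1 ((G.rot.face_faceNext b).trans (G.rot.face_faceNext e))
  have hex := hge.exists_nat_pow_eq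
  have hk := Nat.find_spec hex
  have hmin : ∀ j < Nat.find hex, (G.rot.faceNext ^ j) g ≠ e := fun j hj ↦ Nat.find_min hex hj
  set k := Nat.find hex
  have hgfst : g.fst = b.snd := G.rot.fst_faceNext b
  have hbfst : b.fst = e.snd := G.rot.fst_faceNext e
  obtain hk0 | hk0 := Nat.eq_zero_or_pos k
  -- Here the face is bounded by the two sides of one edge: `e` is the only dart at its start, which
  -- must be `s`, so the face is outer.
  · rw [hk0, pow_zero, Equiv.Perm.one_apply] at hk
    have hbe : b = e.symm := SimpleGraph.Dart.ext _ _ (Prod.ext hbfst (by rw [← hgfst, hk]; rfl))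
    have hfix : G.rot.cw e = e := by
      rw [hgb, hbe, G.rot.faceNext_apply, SimpleGraph.Dart.symm_symm] at hk
      exact hk
    have hall : ∀ e' : G.Dart, e'.fst = e.fst → e' = e := fun e' h ↦
      ((G.rot.sameCycle_of_fst_eq e e' h.symm).eq_of_left hfix).symm
    have hes : e.fst = G.s := (G.isSTGraph.source_iff _).1 fun u hu ↦ by
      have := hall (dart hu).symm rfl
      rw [← this, isOut_symm_iff] at he
      exact he (isOut_dart hu)
    obtain ⟨o, ho, hos⟩ := exists_mem_outer_fst_eq_s (G := G)
    refine hd ((outer_eq ho).2 ?_)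
    rw [hall o (hos.trans hes.symm), hed]
  -- As `e` is the only sink change of the face, the boundary from `g` to `e` is a directed path,
  -- which makes the edge reverse to `b` transitive.
  · have key : ∀ j < k, ReflTransGen G.graph.Adj g.snd ((G.rot.faceNext ^ j) g).snd ∧
        IsOut ((G.rot.faceNext ^ j) g) := by
      intro j hj
      induction j with
      | zero => exact ⟨.refl, hg⟩
      | succ j ih =>
        obtain ⟨h1, h2⟩ := ih (by omega)
        have h3 : IsOut ((G.rot.faceNext ^ (j + 1)) g) := by
          by_contra h3
          rw [pow_succ', Equiv.Perm.mul_apply] at h3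
          refine hmin j (by omega) (injOn_changes.2.1 ⟨h2, h3⟩ ⟨he, heb⟩ ?_)
          rw [G.rot.face_eq_iff]
          exact Equiv.Perm.sameCycle_pow_left.2 hge
        refine ⟨h1.tail ?_, h3⟩
        have h4 : G.graph.Adj _ _ := h3
        have h5 : ((G.rot.faceNext ^ (j + 1)) g).fst = ((G.rot.faceNext ^ j) g).snd := by
          rw [pow_succ', Equiv.Perm.mul_apply, G.rot.fst_faceNext]
        rwa [h5] at h4
    have h1 := (key (k - 1) (by omega)).1
    rw [← G.rot.fst_faceNext ((G.rot.faceNext ^ (k - 1)) g), ← Equiv.Perm.mul_apply, ← pow_succ',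
      Nat.sub_add_cancel hk0, hk] at h1
    refine hG b.snd b.fst ⟨isOut_symm_iff.2 heb, g.snd, ?_, ?_⟩
    · rw [← hgfst]; exact hg
    · rw [hbfst]; exact .tail' h1 he

/-! ### Potentials on the faces, and acyclicity of the augmented graph -/

section Potential

variable {V : Type*} [Fintype V] {G : EmbeddedPlanarSTGraph V}

open RotationSystem

theorem exists_flow {u v : V} (h : ReflTransGen G.graph.Adj u v) : ∃ x : G.Dart → ℚ, 0 ≤ x ∧
    (∀ d, ¬ IsOut d → x d = 0) ∧ netOut _ x = Pi.single u 1 - Pi.single v 1 := by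
  induction h with
  | refl => exact ⟨0, le_rfl, fun _ _ ↦ rfl, by simp⟩
  | tail _ h ih =>
    obtain ⟨x, h0, hx, hn⟩ := ih
    refine ⟨x + Pi.single (dart h) 1, add_nonneg h0 (Pi.single_nonneg.2 zero_le_one),
      fun d hd ↦ ?_, ?_⟩
    · rw [Pi.add_apply, hx d hd, Pi.single_eq_of_ne, add_zero]
      rintro rfl
      exact hd (isOut_dart h)
    · rw [map_add, hn, netOut_single]
      exact sub_add_sub_cancel _ _ _

theorem exists_flow_through (e : G.Dart) : ∃ x : G.Dart → ℚ, 0 ≤ x ∧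
    (∀ d, ¬ IsOut d → x d = 0) ∧ (IsOut e → 1 ≤ x e) ∧
    netOut _ x = Pi.single G.s 1 - Pi.single G.t 1 := by
  by_cases he : IsOut e
  · obtain ⟨x, h0, hx, hn⟩ := exists_flow (reach_from_s G e.fst)
    obtain ⟨y, h0', hy, hn'⟩ := exists_flow (reach_to_t G e.snd)
    refine ⟨x + Pi.single e 1 + y,
      add_nonneg (add_nonneg h0 (Pi.single_nonneg.2 zero_le_one)) h0', fun d hd ↦ ?_, fun _ ↦ ?_, ?_⟩
    · rw [Pi.add_apply, Pi.add_apply, hx d hd, hy d hd, Pi.single_eq_of_ne, add_zero, add_zero]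
      rintro rfl
      exact hd he
    · rw [Pi.add_apply, Pi.add_apply, Pi.single_eq_same]
      linarith [h0 e, h0' e, Pi.zero_apply (M := fun _ : G.Dart ↦ ℚ) e]
    · rw [map_add, map_add, hn, hn', netOut_single, sub_add_sub_cancel, sub_add_sub_cancel]
  · obtain ⟨x, h0, hx, hn⟩ := exists_flow (reach_from_s G G.t)
    exact ⟨x, h0, hx, fun h ↦ (he h).elim, hn⟩

/-- `p` walks along the outer face from `s` to `t`, regardless of the directions of the edges. -/
theorem exists_outer_flow [Nonempty G.Dart] : ∃ p : G.Dart → ℚ, 0 ≤ p ∧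
    (∀ d ∉ G.outer, p d = 0) ∧ netOut _ p = Pi.single G.s 1 - Pi.single G.t 1 := by
  obtain ⟨a, ha, has⟩ := exists_mem_outer_fst_eq_s (G := G)
  obtain ⟨b, hb, hbt⟩ := exists_mem_outer_fst_eq_t (G := G)
  obtain ⟨n, rfl⟩ := (G.rot.face_eq_iff.1 ((outer_eq hb).1 ha)).exists_nat_pow_eq
  rw [← has, ← hbt]
  clear hbt hb
  induction n with
  | zero => exact ⟨0, le_rfl, fun _ _ ↦ rfl, by simp⟩
  | succ n ih =>
    obtain ⟨p, h0, hp, hn⟩ := ih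
    refine ⟨p + Pi.single ((G.rot.faceNext ^ n) a) 1,
      add_nonneg h0 (Pi.single_nonneg.2 zero_le_one), fun d hd ↦ ?_, ?_⟩
    · rw [Pi.add_apply, hp d hd, Pi.single_eq_of_ne, add_zero]
      rintro rfl
      refine hd ((outer_eq ha).2 (G.rot.face_eq_iff.2 ?_))
      exact Equiv.Perm.sameCycle_pow_left.2 (Equiv.Perm.SameCycle.refl _ _)
    · rw [map_add, hn, netOut_single, sub_add_sub_cancel, pow_succ', Equiv.Perm.mul_apply,
        G.rot.fst_faceNext]

theorem exists_strict_potential [Nonempty G.Dart] : ∃ φ : G.rot.Face → ℚ,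
    ∀ d : G.Dart, IsOut d → d ∉ G.outer → φ (G.rot.face d.symm) < φ (G.rot.face d) := by
  choose x h0 hx h1 hn using exists_flow_through (G := G)
  obtain ⟨p, hp0, hp, hpn⟩ := exists_outer_flow (G := G)
  -- One unit from `s` to `t` per dart, balanced by as many copies of the outer walk. That walk uses
  -- only darts with the outer face on their left, so on the reverse of `d` it can only enlarge the
  -- drop across `d`.
  obtain ⟨φ, hφ⟩ := exists_face_potential (y := ∑ e, x e - (Fintype.card G.Dart : ℚ) • p)
    G.isPlanar (connected G) (by
      rw [map_sub, map_sum, map_smul, hpn, Finset.sum_congr rfl fun e _ ↦ hn e, Finset.sum_const,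
        Finset.card_univ, ← Nat.cast_smul_eq_nsmul ℚ, sub_self])
  refine ⟨φ, fun d hd hdo ↦ ?_⟩
  have h := hφ d
  simp only [Pi.sub_apply, Pi.smul_apply, Finset.sum_apply, smul_eq_mul] at h
  rw [hp d hdo, Finset.sum_eq_zero fun e _ ↦ hx e d.symm fun h ↦ isOut_symm_iff.1 h hd] at h
  have h2 : x d d ≤ ∑ e, x e d :=
    Finset.single_le_sum (f := fun e ↦ x e d) (fun e _ ↦ h0 e d) (Finset.mem_univ d)
  have h3 : 0 ≤ (Fintype.card G.Dart : ℚ) * p d.symm := mul_nonneg (Nat.cast_nonneg _) (hp0 _)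
  linarith [h1 d hd]

/-- In `w - w ∘ cw`, a unit of `w` at `d` runs backwards along `cw.symm d` and forwards along `d`.
-/
theorem AugAdj.exists_flow {u v : V} (h : G.AugAdj u v) : ∃ x w, G.IsAugFlow x w ∧
    netOut _ (x + (w - w ∘ G.rot.cw)) = Pi.single u 1 - Pi.single v 1 := by
  obtain h | ⟨d, hd, hd', ho, rfl, rfl⟩ := h
  · refine ⟨Pi.single (dart h) 1, 0, ⟨Pi.single_nonneg.2 zero_le_one, le_rfl, fun d hd ↦ ?_,
      fun _ _ ↦ rfl, fun _ _ ↦ rfl, dart h, by simp⟩, ?_⟩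
    · rw [Pi.single_eq_of_ne]
      rintro rfl
      exact hd (isOut_dart h)
    · rw [Pi.zero_comp, sub_zero, add_zero, netOut_single]
      rfl
  · refine ⟨0, Pi.single (G.rot.cw d) 1, ⟨le_rfl, Pi.single_nonneg.2 zero_le_one, fun _ _ ↦ rfl,
      fun e he ↦ ?_, fun e he ↦ ?_, G.rot.cw d, by simp⟩, ?_⟩
    · rw [Pi.single_eq_of_ne]
      rintro rfl
      exact he ⟨hd', by rwa [Equiv.symm_apply_apply]⟩
    · rw [Pi.single_eq_of_ne]
      rintro rfl
      exact ho he
    · have : (Pi.single (G.rot.cw d) 1 : G.Dart → ℚ) ∘ G.rot.cw = Pi.single d 1 := by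
        funext e
        simp only [Function.comp_apply, Pi.single_apply, EmbeddingLike.apply_eq_iff_eq]
      rw [this, zero_add, map_sub, netOut_single, netOut_single, G.rot.fst_cw, sub_sub_sub_cancel_left]

theorem exists_augFlow {u v : V} (h : TransGen G.AugAdj u v) : ∃ x w, G.IsAugFlow x w ∧
    netOut _ (x + (w - w ∘ G.rot.cw)) = Pi.single u 1 - Pi.single v 1 := by
  induction h with
  | single h => exact h.exists_flow
  | @tail b _ _ h ih =>
    obtain ⟨x, w, hw, hn⟩ := ih
    obtain ⟨x', w', hw', hn'⟩ := h.exists_flow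
    refine ⟨x + x', w + w', hw.add hw', ?_⟩
    rw [← sub_add_sub_cancel _ (Pi.single b 1 : V → ℚ), ← hn, ← hn', ← map_add]
    congr 1
    funext d
    simp only [Pi.add_apply, Pi.sub_apply, Function.comp_apply]
    ring

theorem augAdj_acyclic (hG : IsReduced G.graph) (v : V) : ¬ TransGen G.AugAdj v v := by
  intro hv
  obtain ⟨x, w, hxw, hn⟩ := exists_augFlow hv
  rw [sub_self] at hn
  have : Nonempty G.Dart := hxw.pos.nonempty
  obtain ⟨φ, hφ⟩ := exists_strict_potential (G := G)
  obtain ⟨ψ, hψ⟩ := exists_face_potential G.isPlanar (connected G) hn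
  -- The flow is supported on outgoing darts, so the term of `d.symm` vanishes.
  have hout : ∀ d, IsOut d →
      x d + w d - w (G.rot.cw d) = ψ (G.rot.face d) - ψ (G.rot.face d.symm) := by
    intro d hd
    have hd' : ¬ IsOut d.symm := fun h ↦ isOut_symm_iff.1 h hd
    have h := hψ d
    simp only [Pi.add_apply, Pi.sub_apply, Function.comp_apply] at h
    rw [hxw.isOut _ hd', hxw.mem_sourceDarts d.symm fun h ↦ hd' h.1,
      hxw.mem_sourceDarts (G.rot.cw d.symm) fun h ↦ hd' (by
        simpa only [Equiv.symm_apply_apply] using h.2)] at h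
    linarith
  have hx0 : ∀ d, 0 ≤ x d := hxw.nonneg_left
  have hw0 : ∀ d, 0 ≤ w d := hxw.nonneg_right
  obtain ⟨o, ho, -⟩ := exists_mem_outer_fst_eq_s (G := G)
  -- Among the faces above the outer value take one with greatest `φ`. Across the upper of two
  -- consecutive edges on its left side `ψ` does not decrease, while `φ` increases.
  have upper : ∀ d, ψ (G.rot.face d) ≤ ψ (G.rot.face o) := by
    by_contra! hne
    obtain ⟨d, hd, hmax⟩ := Set.exists_max_image {d | ψ (G.rot.face o) < ψ (G.rot.face d)}
      (fun d ↦ φ (G.rot.face d)) (Set.toFinite _) hne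
    have notOuter : ∀ e, ψ (G.rot.face o) < ψ (G.rot.face e) → e ∉ G.outer := fun e h he ↦
      h.ne' (by rw [(outer_eq ho).1 he])
    obtain ⟨b, hbd, hb, hb'⟩ := exists_consecutive_not_isOut hG (notOuter d hd)
    have h1 := hout b.symm (isOut_symm_iff.2 hb)
    rw [SimpleGraph.Dart.symm_symm, hbd,
      hxw.mem_sourceDarts (G.rot.cw b.symm) fun h ↦ hb' h.1] at h1
    have h2 : ψ (G.rot.face o) < ψ (G.rot.face b.symm) := by
      have : ψ (G.rot.face o) < ψ (G.rot.face d) := hd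
      linarith [hx0 b.symm, hw0 b.symm]
    have h3 := hφ b.symm (isOut_symm_iff.2 hb) (notOuter _ h2)
    rw [SimpleGraph.Dart.symm_symm, hbd] at h3
    exact (hmax _ h2).not_gt h3
  -- The correction by `w g` is what lets a violation propagate from `g` to the face on its right,
  -- where `φ` is smaller.
  have lower : ∀ g ∈ G.sourceDarts, ψ (G.rot.face o) ≤ ψ (G.rot.face g) - w g := by
    by_contra! hne
    obtain ⟨g, ⟨hg, hlt⟩, hmin⟩ := Set.exists_min_image
      {g | g ∈ G.sourceDarts ∧ ψ (G.rot.face g) - w g < ψ (G.rot.face o)}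
      (fun d ↦ φ (G.rot.face d)) (Set.toFinite _) hne
    have hgo : g ∉ G.outer := fun h ↦ by
      rw [hxw.not_mem_outer g h, (outer_eq ho).1 h, sub_zero] at hlt
      exact hlt.false
    -- If `cw g` does not end a source angle, then `w (cw g) = 0` and any source dart of the face on
    -- the right will do.
    obtain ⟨g', hg', hface, hle⟩ : ∃ g' ∈ G.sourceDarts,
        G.rot.face g' = G.rot.face g.symm ∧ w (G.rot.cw g) ≤ w g' := by
      by_cases h : G.rot.cw g ∈ G.sourceDarts
      · exact ⟨_, h, G.rot.face_cw g, le_rfl⟩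
      · obtain ⟨g', hg', hface⟩ := exists_mem_sourceDarts g.symm
        exact ⟨g', hg', hface, (hxw.mem_sourceDarts _ h).trans_le (hw0 _)⟩
    have h1 := hout g hg.1
    refine (hmin g' ⟨hg', ?_⟩).not_gt ?_
    · rw [hface]
      linarith [hx0 g]
    · rw [hface]
      exact hφ g hg.1 hgo
  have hconst : ∀ d, ψ (G.rot.face d) = ψ (G.rot.face o) := fun d ↦ by
    obtain ⟨g, hg, hgd⟩ := exists_mem_sourceDarts d
    rw [← hgd]
    exact (upper g).antisymm (by linarith [lower g hg, hw0 g])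
  have hwz : ∀ d, w d = 0 := fun d ↦ by
    by_cases hd : d ∈ G.sourceDarts
    · linarith [lower d hd, hconst d, hw0 d]
    · exact hxw.mem_sourceDarts d hd
  obtain ⟨d, hd⟩ := hxw.pos
  by_cases h : IsOut d
  · have h1 := hout d h
    rw [hconst, hconst d.symm, sub_self, hwz, hwz] at h1
    rw [hwz] at hd
    linarith
  · rw [hxw.isOut d h, hwz] at hd
    linarith

end Potential

end EmbeddedPlanarSTGraph

/-! ### The ordering -/

/-- In a linear extension, `π v` counts the elements up to and including `v`, so ranks start at `1`.
-/
theorem exists_ranking {V : Type*} [Finite V] {r : V → V → Prop} (hr : ∀ v, ¬ TransGen r v v) :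
    ∃ π : V → ℕ, Set.BijOn π Set.univ (Set.Icc 1 (Nat.card V)) ∧
      ∀ u v, TransGen r u v → π u < π v := by
  have : IsPartialOrder V (ReflTransGen r) :=
    { refl := fun _ ↦ .refl
      trans := fun _ _ _ ↦ .trans
      antisymm := fun u v h h' ↦ by
        obtain h | h := reflTransGen_iff_eq_or_transGen.1 h
        · exact h.symm
        · exact (hr u (h.trans_left h')).elim }
  obtain ⟨s, hs, hrs⟩ := extend_partialOrder (ReflTransGen r)
  let π : V → ℕ := fun v ↦ {u | s u v}.ncard
  have hlt : ∀ u v, s u v → u ≠ v → π u < π v := fun u v h hne ↦ by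
    refine Set.ncard_lt_ncard ((Set.ssubset_iff_of_subset fun a (ha : s a u) ↦ ?_).2
      ⟨v, refl_of s v, fun h' ↦ hne (antisymm_of s h h')⟩) (Set.toFinite _)
    exact trans_of s ha h
  have hinj : Set.InjOn π Set.univ := fun u _ v _ h ↦ by
    by_contra hne
    obtain h' | h' := total_of s u v
    · exact (hlt u v h' hne).ne h
    · exact (hlt v u h' (Ne.symm hne)).ne' h
  have hmaps : Set.MapsTo π Set.univ (Set.Icc 1 (Nat.card V)) := fun v _ ↦
    ⟨(Set.ncard_pos (Set.toFinite _)).2 ⟨v, refl_of s v⟩, Set.ncard_le_card _⟩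
  refine ⟨π, ⟨hmaps, hinj, ?_⟩, fun u v h ↦ hlt u v (hrs _ _ h.to_reflTransGen) ?_⟩
  · refine (Set.eq_of_subset_of_ncard_le hmaps.image_subset ?_ (Set.finite_Icc _ _)).ge
    rw [hinj.ncard_image, Set.ncard_univ, ← Finset.coe_Icc, Set.ncard_coe_finset,
      Nat.card_Icc, Nat.add_sub_cancel]
  · rintro rfl
    exact hr u h

theorem exists_step {p : ℕ → Prop} {a b : ℕ} (hab : a ≤ b) (ha : ¬ p a) (hb : p b) :
    ∃ m, a ≤ m ∧ m < b ∧ ¬ p m ∧ p (m + 1) := by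
  by_contra! h
  refine Nat.le_induction (P := fun n _ ↦ n ≤ b → ¬ p n) (fun _ ↦ ha) (fun n hn ih hb' ↦ ?_) b hab
    le_rfl hb
  exact h n hn hb' (ih (by omega))

/-! ### Successor lists in clockwise order -/

namespace EmbeddedPlanarSTGraph

variable {V : Type*} {G : EmbeddedPlanarSTGraph V}

theorem fst_iterate_cw (d : G.Dart) (n : ℕ) : (G.rot.cw^[n] d).fst = d.fst := by
  induction n with
  | zero => rfl
  | succ n ih => rw [Function.iterate_succ_apply', G.rot.fst_cw, ih]

variable [Finite V]

/-- The orbit of `d` reaches every neighbour, so its period is at least the degree. -/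
theorem injOn_iterate_cw (d : G.Dart) : Set.InjOn (fun i ↦ G.rot.cw^[i] d)
    (Set.Iio (G.graph.toSimpleGraphInclusive.neighborSet d.fst).ncard) := by
  refine Function.iterate_injOn_Iio_minimalPeriod.mono (Set.Iio_subset_Iio ?_)
  set p := Function.minimalPeriod G.rot.cw d
  have hp : 0 < p := Function.minimalPeriod_pos_of_mem_periodicPts
    (G.rot.cw.injective.mem_periodicPts d)
  have hsub : G.graph.toSimpleGraphInclusive.neighborSet d.fst ⊆
      (fun i ↦ (G.rot.cw^[i] d).snd) '' Set.Iio p := by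
    intro w hw
    obtain ⟨m, hm⟩ := (G.rot.sameCycle_of_fst_eq d ⟨(d.fst, w), hw⟩ rfl).exists_nat_pow_eq
    refine ⟨m % p, Nat.mod_lt _ hp, ?_⟩
    change (G.rot.cw^[m % p] d).snd = w
    rw [Function.iterate_mod_minimalPeriod_eq, Equiv.Perm.iterate_eq_pow, hm]
  refine (Set.ncard_le_ncard hsub (Set.toFinite _)).trans
    ((Set.ncard_image_le (Set.finite_Iio p)).trans ?_)
  rw [← Finset.coe_Iio, Set.ncard_coe_finset, Nat.card_Iio]

theorem isOut_iterate_cw_of_between {d : G.Dart} (hd : G.IsStart d) {i j k : ℕ} (hik : i ≤ k)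
    (hkj : k ≤ j) (hj : j < (G.graph.toSimpleGraphInclusive.neighborSet d.fst).ncard)
    (hi' : IsOut (G.rot.cw^[i] d)) (hj' : IsOut (G.rot.cw^[j] d)) : IsOut (G.rot.cw^[k] d) := by
  have : Nonempty G.Dart := ⟨d⟩
  obtain ⟨hs, -⟩ | ⟨-, hd⟩ := hd
  · exact isOut_of_fst_eq_s ((fst_iterate_cw d k).trans hs)
  · by_contra hk'
    -- As the list begins with an incoming edge, a gap at `k` would give two changes from incoming
    -- to outgoing, at `m < i` and at `n ≥ k`.
    obtain ⟨m, -, hm, hm'⟩ := exists_step (p := fun i ↦ IsOut (G.rot.cw^[i] d)) (Nat.zero_le i)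
      (not_adj_symm hd) hi'
    obtain ⟨n, hn, hnj, hn'⟩ := exists_step (p := fun i ↦ IsOut (G.rot.cw^[i] d)) hkj hk' hj'
    simp only [Function.iterate_succ_apply'] at hm' hn'
    have := injOn_iterate_cw d (Set.mem_Iio.2 (by omega)) (Set.mem_Iio.2 (by omega))
      (injOn_changes.1 hm' hn' ((fst_iterate_cw d m).trans (fst_iterate_cw d n).symm))
    omega

theorem augAdj_iterate_cw {d : G.Dart} (hd : G.IsStart d) {k : ℕ}
    (hk : k + 1 < (G.graph.toSimpleGraphInclusive.neighborSet d.fst).ncard)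
    (h : IsOut (G.rot.cw^[k] d)) (h' : IsOut (G.rot.cw^[k + 1] d)) :
    G.AugAdj (G.rot.cw^[k] d).snd (G.rot.cw^[k + 1] d).snd := by
  rw [Function.iterate_succ_apply'] at h' ⊢
  refine .inr ⟨_, h, h', fun ho ↦ ?_, rfl, rfl⟩
  rw [← Function.iterate_succ_apply' G.rot.cw] at ho h'
  -- An outer source angle lies at `s`, where the only outer dart is `d` itself, of index `0`, not
  -- `k + 1`.
  have hs : d.fst = G.s := by
    rw [← fst_iterate_cw d (k + 1)]
    refine fst_eq_s_of_mem_sourceDarts ⟨h', ?_⟩ ho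
    rwa [Function.iterate_succ_apply', Equiv.symm_apply_apply]
  obtain ⟨-, hdo⟩ | ⟨hs', -⟩ := hd
  · have := injOn_iterate_cw d (Set.mem_Iio.2 hk) (Set.mem_Iio.2 (by omega))
      (eq_of_mem_outer ho hdo ((fst_iterate_cw d _).trans hs) hs : _ = G.rot.cw^[0] d)
    omega
  · exact hs' hs

theorem pairwise_successorList {π : V → ℕ} (hπ : ∀ u v, TransGen G.AugAdj u v → π u < π v)
    {d : G.Dart} (hd : G.IsStart d) : (G.successorList d).Pairwise fun u v ↦ π u < π v := by
  rw [successorList, List.pairwise_filter, List.pairwise_map, List.pairwise_iff_getElem]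
  intro i j hi hj hij
  simp only [clockwiseFrom, List.length_iterate] at hi hj
  simp only [clockwiseFrom, List.getElem_iterate, decide_eq_true_eq]
  intro hi' hj'
  have key : ∀ k, G.graph.Adj d.fst (G.rot.cw^[k] d).snd → IsOut (G.rot.cw^[k] d) := by
    intro k h
    rwa [← fst_iterate_cw d k] at h
  have between : ∀ k, i ≤ k → k ≤ j → IsOut (G.rot.cw^[k] d) := fun k h h' ↦
    isOut_iterate_cw_of_between hd h h' hj (key i hi') (key j hj')
  refine Nat.le_induction (P := fun k _ ↦ k ≤ j → π (G.rot.cw^[i] d).snd < π (G.rot.cw^[k] d).snd)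
    (fun h ↦ ?_) (fun k hk ih h ↦ ?_) j hij le_rfl
  · exact hπ _ _ (.single (augAdj_iterate_cw hd (by omega) (between i le_rfl (by omega))
      (between _ (by omega) h)))
  · exact (ih (by omega)).trans (hπ _ _ (.single (augAdj_iterate_cw hd (by omega)
      (between k (by omega) (by omega)) (between _ (by omega) h))))

end EmbeddedPlanarSTGraph

theorem isBitonic_of_pairwise_lt {V : Type*} {π : V → ℕ} {l : List V}
    (h : l.Pairwise fun u v ↦ π u < π v) : IsBitonic π l := by
  intro hl
  have hpos := List.length_pos_iff.2 hl
  -- The peak is the last index, so the decreasing part is empty.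
  refine ⟨l.length - 1, by omega, fun i hi ↦ ⟨fun _ ↦ ?_, fun h' ↦ by omega⟩⟩
  exact List.pairwise_iff_getElem.1 h i (i + 1) (by omega) hi (Nat.lt_succ_self i)

open EmbeddedPlanarSTGraph in
/-- Every reduced planar `st`-graph admits a bitonic `st`-ordering. -/
theorem exists_isBitonicSTOrdering {V : Type*} [Finite V] (G : EmbeddedPlanarSTGraph V)
    (hG : IsReduced G.graph) : ∃ π : V → ℕ, G.IsBitonicSTOrdering π := by
  cases nonempty_fintype V
  obtain ⟨π, hπ, hlt⟩ := exists_ranking (augAdj_acyclic hG)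
  have hreach : ∀ {u v}, ReflTransGen G.graph.Adj u v → π u ≤ π v := by
    intro u v h
    obtain rfl | h := reflTransGen_iff_eq_or_transGen.1 h
    · exact le_rfl
    · exact (hlt _ _ (TransGen.mono (fun _ _ ↦ Or.inl) _ _ h)).le
  have hcard : 1 ≤ Nat.card V := (hπ.mapsTo (Set.mem_univ G.s)).1.trans
    (hπ.mapsTo (Set.mem_univ G.s)).2
  refine ⟨π, ⟨hπ, ?_, ?_, fun u v h ↦ hlt _ _ (.single (.inl h))⟩, fun d hd ↦
    isBitonic_of_pairwise_lt (pairwise_successorList hlt hd)⟩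
  -- The vertex of rank `1` is reachable from `s`, so `s` has rank at most `1`; dually for `t`.
  · obtain ⟨v, -, hv⟩ := hπ.surjOn (Set.left_mem_Icc.2 hcard)
    exact ((hreach (reach_from_s G v)).trans hv.le).antisymm (hπ.mapsTo (Set.mem_univ _)).1
  · obtain ⟨v, -, hv⟩ := hπ.surjOn (Set.right_mem_Icc.2 hcard)
    exact (hπ.mapsTo (Set.mem_univ _)).2.antisymm (hv.ge.trans (hreach (reach_to_t G v)))

end PlanarST

theorem mainTheorem8 {V : Type*} [Finite V] (G : PlanarST.EmbeddedPlanarSTGraph V)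
    (hG : PlanarST.IsReduced G.graph) :
    ∃ π : V → ℕ, G.IsBitonicSTOrdering π := by
  exact PlanarST.exists_isBitonicSTOrdering G hG
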